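/- Let $d\ge 2$. For $(c,a)=(c_1,\dots,c_{d-2},a)\in\mathbb C^{d-1}$ put $c_0=0$ and $$P_{c,a}(z)=\frac1d z^d+\sum_{j=2}^{d-1}(-1)^{d-j}\sigma_{d-j}(c)\frac{z^j}{j}+a^d,$$ where $\sigma_k$ is the $k$-th elementary symmetric polynomial in $c_1,\dots,c_{d-2}$, so that $c_0,\dots,c_{d-2}$ are the critical points of $P_{c,a}$. For $0\le i\le d-2$ and integers $m>n\ge 0$ let $\mathrm{Per}_i(m,n)\subset\mathbb C^{d-1}$ be the hypersurface $\{(c,a): P_{c,a}^m(c_i)=P_{c,a}^n(c_i)\}$ (iterates of $P_{c,a}$), taken with its reduced structure. For tuples $\underline m=(m_0,\dots,m_{d-2})$ and $\underline n=(n_0,\dots,n_{d-2})$ of non-negative integers with $m_i>n_i$ for all $i$, let $\mathrm{TPCF}(\underline m,\underline n)$ be the set of points of $\bigcap_{i=0}^{d-2}\mathrm{Per}_i(m_i,n_i)$ at which the $d-1$ hypersurfaces $\mathrm{Per}_i(m_i,n_i)$ are all smooth and intersect transversely, and write $|\underline m|=m_0+\dots+m_{d-2}$. Let $(\underline m_k)_k$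 and $(\underline n_k)_k$ be two sequences of $(d-1)$-tuples of non-negative integers such that $m_{k,i}>n_{k,i}$ for all $k$ and $i$, and $m_{k,i}\to\infty$ as $k\to\infty$ for every $0\le i\le d-2$. Then for every proper closed algebraic subset $V\subsetneq\mathbb A^{d-1}_{\mathbb C}$ (not necessarily irreducible), the sets $V\cap\mathrm{TPCF}(\underline m_k,\underline n_k)$ are finite and $$\mathrm{card}\bigl(V\cap\mathrm{TPCF}(\underline m_k,\underline n_k)\bigr)=o\bigl(d^{|\underline m_k|}\bigr)\qquad (k\to\infty).$$ -/

import Mathlib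

/-! ### Smoothness and transversality of hypersurfaces in affine space -/

/-- The (Zariski) tangent space at `p` of a subset `Z` of the affine space `ℂ^σ`: the vectors
killed by the differentials at `p` of all polynomials vanishing on `Z`. Thus an algebraic set is
considered with its reduced structure. -/
noncomputable def tangentSpaceAt {σ : Type*} [Fintype σ] (Z : Set (σ → ℂ)) (p : σ → ℂ) :
    Submodule ℂ (σ → ℂ) where
  carrier := {v | ∀ f ∈ MvPolynomial.vanishingIdeal ℂ Z,
    ∑ s, MvPolynomial.eval p (MvPolynomial.pderiv s f) * v s = 0}
  zero_mem' := by
    intro f _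
    simp
  add_mem' := by
    intro v w hv hw f hf
    simp only [Pi.add_apply, mul_add, Finset.sum_add_distrib]
    rw [hv f hf, hw f hf, add_zero]
  smul_mem' := by
    intro t v hv f hf
    have h : ∑ s, MvPolynomial.eval p (MvPolynomial.pderiv s f) * (t • v) s
        = t * ∑ s, MvPolynomial.eval p (MvPolynomial.pderiv s f) * v s := by
      rw [Finset.mul_sum]
      refine Finset.sum_congr rfl fun s _ => ?_
      simp only [Pi.smul_apply, smul_eq_mul]
      ring
    rw [h, hv f hf, mul_zero]

/-- A hypersurface `H` of `ℂ^σ` (pure codimension one) is smooth at the point `p ∈ H`: its tangent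
space at `p` is a hyperplane, i.e. has the dimension of `H`. -/
def HypersurfaceSmoothAt {σ : Type*} [Fintype σ] (H : Set (σ → ℂ)) (p : σ → ℂ) : Prop :=
  p ∈ H ∧ Module.finrank ℂ (tangentSpaceAt H p) + 1 = Fintype.card σ

/-- Finitely many hypersurfaces `H i`, smooth at `p`, intersect transversely at `p`: the
intersection of their tangent hyperplanes has codimension the number of hypersurfaces. -/
def HypersurfacesTransverseAt {σ ι : Type*} [Fintype σ] [Fintype ι]
    (H : ι → Set (σ → ℂ)) (p : σ → ℂ) : Prop :=
  Module.finrank ℂ (⨅ i, tangentSpaceAt (H i) p : Submodule ℂ (σ → ℂ)) + Fintype.card ι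
    = Fintype.card σ

/-! ### The family `P_{c,a}` of degree `d` polynomials with marked critical points -/

/-- Index set of the `d - 1` coordinates `(c₁, …, c_{d-2}, a)`: the index `Sum.inl j` is that of
`c_{j+1}` and the index `Sum.inr ()` is that of `a`. -/
abbrev ParamIndex (d : ℕ) : Type := Fin (d - 2) ⊕ Unit

/-- The parameter space `𝔸^{d-1}(ℂ)`. -/
abbrev ParamSpace (d : ℕ) : Type := ParamIndex d → ℂ

/-- The part `c = (c₁, …, c_{d-2})` of a parameter `(c, a)`. -/
def paramC {d : ℕ} (x : ParamSpace d) : Fin (d - 2) → ℂ := fun j => x (Sum.inl j)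

/-- The part `a` of a parameter `(c, a)`. -/
def paramA {d : ℕ} (x : ParamSpace d) : ℂ := x (Sum.inr ())

/-- The marked critical points `c₀ = 0, c₁, …, c_{d-2}`. -/
def critPoint {d : ℕ} (x : ParamSpace d) (i : Fin (d - 1)) : ℂ :=
  if h : (i : ℕ) = 0 then 0 else paramC x ⟨(i : ℕ) - 1, by omega⟩

/-- `P_{c,a}(z) = z^d / d + ∑_{j=2}^{d-1} (-1)^{d-j} σ_{d-j}(c) z^j / j + a^d`, where `σ_k` is the
`k`-th elementary symmetric polynomial. -/
noncomputable def critPoly {d : ℕ} (x : ParamSpace d) : Polynomial ℂ :=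
  Polynomial.C (1 / (d : ℂ)) * Polynomial.X ^ d
    + ∑ j ∈ Finset.Icc 2 (d - 1),
        Polynomial.C ((-1 : ℂ) ^ (d - j)
            * MvPolynomial.eval (paramC x) (MvPolynomial.esymm (Fin (d - 2)) ℂ (d - j)) / (j : ℂ))
          * Polynomial.X ^ j
    + Polynomial.C (paramA x ^ d)

/-- The `k`-th iterate `P_{c,a}^k(c_i)` of the marked critical point `c_i`. -/
noncomputable def critOrbit {d : ℕ} (x : ParamSpace d) (i : Fin (d - 1)) (k : ℕ) : ℂ :=
  (fun z : ℂ => (critPoly x).eval z)^[k] (critPoint x i)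

/-- `Per_i(m, n) = {(c, a) : P_{c,a}^m(c_i) = P_{c,a}^n(c_i)}`. -/
def PerLocus {d : ℕ} (i : Fin (d - 1)) (m n : ℕ) : Set (ParamSpace d) :=
  {x | critOrbit x i m = critOrbit x i n}

/-- `PCF(m, n) = ⋂_i Per_i(m_i, n_i)`. -/
def PCF {d : ℕ} (m n : Fin (d - 1) → ℕ) : Set (ParamSpace d) :=
  ⋂ i, PerLocus i (m i) (n i)

/-- `TPCF(m, n)`: the points of `PCF(m, n)` at which the hypersurfaces `Per_i(m_i, n_i)` are smooth
and transverse. -/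
def TPCF {d : ℕ} (m n : Fin (d - 1) → ℕ) : Set (ParamSpace d) :=
  {x | x ∈ PCF m n ∧ (∀ i, HypersurfaceSmoothAt (PerLocus i (m i) (n i)) x) ∧
    HypersurfacesTransverseAt (fun i => PerLocus i (m i) (n i)) x}

/-- Closed algebraic subsets of `ℂ^σ` (not necessarily irreducible). -/
def IsAlgebraicSubset {σ : Type*} (V : Set (σ → ℂ)) : Prop :=
  ∃ I : Ideal (MvPolynomial σ ℂ), V = MvPolynomial.zeroLocus ℂ I

/-! Replace each `PerLocus` by a generator `g i` of its reduced ideal, of degree at most `d ^ m i`.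
A point of `TPCF` is then a nondegenerate zero of a square system, and V lies in some {f = 0} with f
≠ 0. At each zero of f, some h from a finite list of iterated derivatives of f vanishes with nonzero
differential (`exists_finset_simple_zero`), so h can replace one `g j` without losing nondegeneracy
(`IsNondegenerateZero.exists_update`). The degree of h is bounded independently of k, so Bézout
loses the factor `d ^ m j`, which tends to infinity. A Bézout bound up to a constant suffices
(`card_nondegenerateZeros_le`). It comes from a dimension count: a system f with s nondegenerate
zeros makes 1, u, …, u^(s-1) independent over ℂ[f], and a space of polynomials of bounded degree has
no room for too many products f^β u^k. -/

open MvPolynomial Filter Topology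

/-! ### Nondegenerate zeros and independence over ℂ[f] -/

section Bezout

variable {σ ι : Type*} [Fintype σ] [Fintype ι]

/-- The differential at `p` of a polynomial function on `ℂ^σ`. -/
noncomputable def differentialAt (f : MvPolynomial σ ℂ) (p : σ → ℂ) : (σ → ℂ) →L[ℂ] ℂ :=
  ∑ s, eval p (pderiv s f) • ContinuousLinearMap.proj (R := ℂ) (φ := fun _ : σ => ℂ) s

theorem differentialAt_apply (f : MvPolynomial σ ℂ) (p v : σ → ℂ) :
    differentialAt f p v = ∑ s, eval p (pderiv s f) * v s := by
  simp [differentialAt]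

theorem differentialAt_C (c : ℂ) (p : σ → ℂ) : differentialAt (C c) p = 0 := by
  ext v; simp [differentialAt_apply]

theorem differentialAt_X (s : σ) (p : σ → ℂ) :
    differentialAt (X s) p = ContinuousLinearMap.proj (R := ℂ) (φ := fun _ : σ => ℂ) s := by
  classical
  ext v
  simp [differentialAt_apply, pderiv_X, Pi.single_apply, apply_ite (eval p)]

theorem differentialAt_add (f g : MvPolynomial σ ℂ) (p : σ → ℂ) :
    differentialAt (f + g) p = differentialAt f p + differentialAt g p := by
  ext v; simp [differentialAt_apply, add_mul, Finset.sum_add_distrib]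

theorem differentialAt_mul (f g : MvPolynomial σ ℂ) (p : σ → ℂ) :
    differentialAt (f * g) p = eval p f • differentialAt g p + eval p g • differentialAt f p := by
  ext v
  simp only [differentialAt_apply, pderiv_mul, map_add, map_mul, add_mul, Finset.sum_add_distrib,
    add_apply, smul_apply, smul_eq_mul, Finset.mul_sum]
  rw [add_comm]
  congr 1 <;> exact Finset.sum_congr rfl fun s _ => by ring

theorem hasStrictFDerivAt_eval (f : MvPolynomial σ ℂ) (p : σ → ℂ) :
    HasStrictFDerivAt (fun x => eval x f) (differentialAt f p) p := by
  induction f using MvPolynomial.induction_on with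
  | C c =>
    rw [differentialAt_C]
    simpa using hasStrictFDerivAt_const c p
  | add f g hf hg =>
    rw [differentialAt_add]
    simp only [map_add]
    exact hf.add hg
  | mul_X f s hf =>
    rw [differentialAt_mul, differentialAt_X]
    simpa [Pi.mul_def] using hf.mul (hasStrictFDerivAt_apply (𝕜 := ℂ) s p)

/-- `p` is a common zero of the `f i` at which their differentials have trivial common kernel. -/
def IsNondegenerateZero (f : ι → MvPolynomial σ ℂ) (p : σ → ℂ) : Prop :=
  (∀ i, eval p (f i) = 0) ∧ ∀ v, (∀ i, differentialAt (f i) p v = 0) → v = 0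

/-- In equal dimensions an injective differential is surjective, so the map is open at p. -/
theorem IsNondegenerateZero.map_nhds_eq {f : ι → MvPolynomial σ ℂ} {p : σ → ℂ}
    (hcard : Fintype.card σ = Fintype.card ι) (h : IsNondegenerateZero f p) :
    map (fun x i => eval x (f i)) (𝓝 p) = 𝓝 (0 : ι → ℂ) := by
  have hF : HasStrictFDerivAt (fun x i => eval x (f i))
      (ContinuousLinearMap.pi fun i => differentialAt (f i) p) p :=
    hasStrictFDerivAt_pi.2 fun i => hasStrictFDerivAt_eval (f i) p
  have h0 : (fun i => eval p (f i)) = (0 : ι → ℂ) := funext h.1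
  have hinj : Function.Injective
      (ContinuousLinearMap.pi fun i => differentialAt (f i) p : (σ → ℂ) →ₗ[ℂ] (ι → ℂ)) := by
    rw [← LinearMap.ker_eq_bot, LinearMap.ker_eq_bot']
    intro v hv
    exact h.2 v fun i => congrFun hv i
  have hsurj := (LinearMap.injective_iff_surjective_of_finrank_eq_finrank
    (by simp [hcard])).1 hinj
  have := hF.map_nhds_eq_of_surj (LinearMap.range_eq_top.2 hsurj)
  rwa [h0] at this

/-- A functional that is nonzero on the finitely many differences exists because ℂ is infinite. -/
theorem exists_linear_separating (S : Finset (σ → ℂ)) :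
    ∃ u : σ → ℂ, Set.InjOn (fun p : σ → ℂ => ∑ s, u s * p s) S := by
  classical
  let v : {q // q ∈ S.offDiag} → (σ → ℂ) := fun q => q.1.1 - q.1.2
  obtain ⟨φ, hφ⟩ := Module.exists_dual_forall_apply_ne_zero (K := ℂ) v (by
    rintro ⟨⟨a, b⟩, h⟩
    exact sub_ne_zero.2 (Finset.mem_offDiag.1 h).2.2)
  have key : ∀ p : σ → ℂ, φ p = ∑ s, φ (Pi.single s 1) * p s := by
    intro p
    conv_lhs => rw [← Finset.univ_sum_single p, map_sum]
    refine Finset.sum_congr rfl fun s _ => ?_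
    have : (Pi.single s (p s) : σ → ℂ) = p s • Pi.single s 1 := by
      rw [← Pi.single_smul, smul_eq_mul, mul_one]
    rw [this, map_smul, smul_eq_mul, mul_comm]
  refine ⟨fun s => φ (Pi.single s 1), fun a ha b hb hab => ?_⟩
  by_contra hne
  refine hφ ⟨⟨a, b⟩, Finset.mem_offDiag.2 ⟨ha, hb, hne⟩⟩ ?_
  change φ (a - b) = 0
  rw [map_sub, key a, key b]
  exact sub_eq_zero.2 hab

/-- If `u` separates the nondegenerate zeros `p ∈ S` of `f`, then `1, u, …, u ^ (#S - 1)` are linearly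
independent over the polynomials in `f`. -/
theorem eq_zero_of_sum_aeval_mul_pow_eq_zero (hcard : Fintype.card σ = Fintype.card ι)
    {f : ι → MvPolynomial σ ℂ} {S : Finset (σ → ℂ)} (hS : ∀ p ∈ S, IsNondegenerateZero f p)
    {u : MvPolynomial σ ℂ} (hu : Set.InjOn (fun p => eval p u) S)
    {a : Fin S.card → MvPolynomial ι ℂ} (ha : ∑ k, aeval f (a k) * u ^ (k : ℕ) = 0) :
    ∀ k, a k = 0 := by
  obtain ⟨U, hU, hdisj⟩ := (S.finite_toSet.image fun p => eval p u).t2_separation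
  -- Every y near 0 has, for each p in S, a preimage whose u-value lies in the neighbourhood of
  -- u(p).
  have hW : ∀ p ∈ S, (fun x i => eval x (f i)) '' {x | eval x u ∈ U (eval p u)} ∈ 𝓝 (0 : ι → ℂ) := by
    intro p hp
    rw [← (hS p hp).map_nhds_eq hcard]
    refine image_mem_map ?_
    exact (hasStrictFDerivAt_eval u p).continuousAt.preimage_mem_nhds
      ((hU (eval p u)).2.mem_nhds (hU _).1)
  obtain ⟨ε, hε, hball⟩ := Metric.mem_nhds_iff.1 ((biInter_finset_mem S).2 hW)
  have hzero : ∀ y ∈ Metric.ball (0 : ι → ℂ) ε, ∀ k, eval y (a k) = 0 := by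
    intro y hy k
    have hy' := hball hy
    simp only [Set.mem_iInter, Set.mem_image, Set.mem_ofPred_eq] at hy'
    choose! x hxU hxy using hy'
    let q : Polynomial ℂ := ∑ k : Fin S.card, Polynomial.C (eval y (a k)) * Polynomial.X ^ (k : ℕ)
    -- The degree of q is below #S, yet the u-values of the #S preimages of y are distinct roots.
    have hq : q = 0 := by
      refine Polynomial.eq_zero_of_degree_lt_of_eval_index_eq_zero S (v := fun p => eval (x p) u)
        ?_ (Polynomial.degree_sum_fin_lt _) ?_
      · intro p hp p' hp' hpp
        by_contra hne
        refine Set.disjoint_left.1 (hdisj (Set.mem_image_of_mem _ hp) (Set.mem_image_of_mem _ hp')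
          fun h => hne (hu hp hp' h)) (hxU p hp) ?_
        have := hxU p' hp'
        simp only at hpp
        rwa [← hpp] at this
      · intro p hp
        have h := congrArg (eval (x p)) ha
        simp only [map_sum, map_mul, map_pow, map_zero] at h
        simp only [q, Polynomial.eval_finsetSum, Polynomial.eval_mul, Polynomial.eval_C,
          Polynomial.eval_pow, Polynomial.eval_X]
        rw [← h]
        refine Finset.sum_congr rfl fun k _ => ?_
        congr 1
        have : eval (x p) (aeval f (a k)) = eval (fun i => eval (x p) (f i)) (a k) := by
          have := comp_aeval_apply (φ := (aeval (x p) : MvPolynomial σ ℂ →ₐ[ℂ] ℂ)) f (a k)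
          simpa [aeval_eq_eval] using this
        rw [this, hxy p hp]
    have := congrArg (fun r => Polynomial.coeff r (k : ℕ)) hq
    simpa [q, Polynomial.finsetSum_coeff, Polynomial.coeff_C_mul, Polynomial.coeff_X_pow,
      Fin.val_inj] using this
  intro k
  refine MvPolynomial.funext_set (fun _ => Metric.ball (0 : ℂ) ε)
    (fun _ => infinite_of_mem_nhds 0 (Metric.ball_mem_nhds _ hε)) fun y hy => ?_
  rw [map_zero]
  refine hzero y ?_ k
  rw [ball_pi _ hε]
  exact hy

end Bezout
-- Derivatives and reduced equations of hypersurfaces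
section Derivatives

variable {σ : Type*}

theorem totalDegree_pderiv_le (f : MvPolynomial σ ℂ) (s : σ) :
    (pderiv s f).totalDegree ≤ f.totalDegree - 1 := by
  classical
  refine Finset.sup_le fun m hm => ?_
  rw [mem_support_iff, coeff_pderiv] at hm
  have := le_totalDegree (mem_support_iff.2 (left_ne_zero_of_mul hm))
  rw [Finsupp.sum_add_index' (fun _ => rfl) (fun _ _ _ => rfl),
    Finsupp.sum_single_index rfl] at this
  omega

theorem exists_pderiv_ne_zero {f : MvPolynomial σ ℂ} (hf : f.totalDegree ≠ 0) :
    ∃ s, pderiv s f ≠ 0 := by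
  classical
  by_contra! h
  refine hf ((totalDegree_eq_zero_iff _ f).2 fun m hm s => ?_)
  by_contra hms
  have := congrArg (coeff (m - Finsupp.single s 1)) (h s)
  rw [coeff_pderiv, coeff_zero, tsub_add_cancel_of_le (by
    simpa [Finsupp.single_le_iff] using Nat.one_le_iff_ne_zero.2 hms)] at this
  rcases mul_eq_zero.1 this with h0 | h0
  · exact mem_support_iff.1 hm h0
  · exact Nat.cast_add_one_ne_zero _ h0

/-- Every zero of `f ≠ 0` is a zero of an iterated partial derivative of `f` whose differential does
not vanish there; finitely many derivatives suffice. -/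
theorem exists_finset_simple_zero [Fintype σ] (f : MvPolynomial σ ℂ) (hf : f ≠ 0) :
    ∃ S : Finset (MvPolynomial σ ℂ), ∀ p, eval p f = 0 →
      ∃ h ∈ S, eval p h = 0 ∧ ∃ s, eval p (pderiv s h) ≠ 0 := by
  classical
  induction hn : f.totalDegree using Nat.strong_induction_on generalizing f with
  | _ n ih =>
    subst hn
    by_cases h0 : f.totalDegree = 0
    · refine ⟨∅, fun p hp => (hf ?_).elim⟩
      rw [totalDegree_eq_zero_iff_eq_C.1 h0, eval_C] at hp
      rw [totalDegree_eq_zero_iff_eq_C.1 h0, hp, C_0]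
    obtain ⟨s, hs⟩ := exists_pderiv_ne_zero h0
    obtain ⟨S, hS⟩ := ih _ ((totalDegree_pderiv_le f s).trans_lt (by omega)) _ hs rfl
    refine ⟨insert f S, fun p hp => ?_⟩
    -- If this derivative also vanishes at p, induct on it; otherwise f itself is simple at p.
    by_cases hp' : eval p (pderiv s f) = 0
    · obtain ⟨h, hh, H⟩ := hS p hp'
      exact ⟨h, Finset.mem_insert_of_mem hh, H⟩
    · exact ⟨f, Finset.mem_insert_self _ _, hp, s, hp'⟩

/-- The reduced ideal of a hypersurface is principal, with a generator of no larger degree. -/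
theorem exists_vanishingIdeal_eq_span [Fintype σ] (F : MvPolynomial σ ℂ) :
    ∃ g : MvPolynomial σ ℂ, g.totalDegree ≤ F.totalDegree ∧
      vanishingIdeal ℂ {x : σ → ℂ | eval x F = 0} = Ideal.span {g} := by
  classical
  have hZ : {x : σ → ℂ | eval x F = 0} = zeroLocus ℂ (Ideal.span {F}) := by
    rw [zeroLocus_span]
    ext x
    simp [aeval_eq_eval]
  rw [hZ, vanishingIdeal_zeroLocus_eq_radical]
  -- The generator is the squarefree part of F; `radical 0` is 1, so F = 0 is treated apart.
  by_cases hF : F = 0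
  · refine ⟨0, by simp, ?_⟩
    subst hF
    ext x
    simp
  · let : StrongNormalizationMonoid (MvPolynomial σ ℂ) :=
      UniqueFactorizationMonoid.strongNormalizationMonoid
    refine ⟨UniqueFactorizationMonoid.radical F,
      totalDegree_le_of_dvd_of_isDomain UniqueFactorizationMonoid.radical_dvd_self hF, ?_⟩
    ext x
    simp only [Ideal.mem_radical_iff, Ideal.mem_span_singleton]
    exact UniqueFactorizationMonoid.exists_dvd_pow_iff_radical_dvd hF

end Derivatives

/-! ### Degrees of the critical orbits in the parameters -/

section CriticalOrbits

theorem totalDegree_esymm_le {τ : Type*} [Fintype τ] (k : ℕ) :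
    (esymm τ ℂ k).totalDegree ≤ k := by
  refine totalDegree_finsetSum_le fun t ht => ?_
  refine (totalDegree_finsetProd _ _).trans ?_
  simp [(Finset.mem_powersetCard.1 ht).2]

theorem exists_critPoint_polynomial {d : ℕ} (i : Fin (d - 1)) :
    ∃ q : MvPolynomial (ParamIndex d) ℂ, q.totalDegree ≤ 1 ∧
      ∀ x : ParamSpace d, eval x q = critPoint x i := by
  by_cases h : (i : ℕ) = 0
  · exact ⟨0, by simp, fun x => by simp [critPoint, h]⟩
  · exact ⟨X (Sum.inl ⟨(i : ℕ) - 1, by omega⟩), by simp, fun x => by simp [critPoint, h, paramC]⟩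

/-- `P_{c,a}(z)` is a polynomial of weighted degree `d` in `(c, a, z)`. -/
theorem exists_critPoly_comp_polynomial {d : ℕ} {D : ℕ} (hD : 1 ≤ D)
    (q : MvPolynomial (ParamIndex d) ℂ) (hq : q.totalDegree ≤ D) :
    ∃ r : MvPolynomial (ParamIndex d) ℂ, r.totalDegree ≤ d * D ∧
      ∀ x : ParamSpace d, eval x r = (critPoly x).eval (eval x q) := by
  have hpow : ∀ j, (q ^ j).totalDegree ≤ j * D := fun j =>
    (totalDegree_pow _ _).trans (Nat.mul_le_mul_left _ hq)
  refine ⟨C (1 / (d : ℂ)) * q ^ d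
    + ∑ j ∈ Finset.Icc 2 (d - 1),
        C ((-1 : ℂ) ^ (d - j) / (j : ℂ)) * rename Sum.inl (esymm (Fin (d - 2)) ℂ (d - j)) * q ^ j
    + X (Sum.inr ()) ^ d, ?_, fun x => ?_⟩
  · refine (totalDegree_add _ _).trans (max_le ((totalDegree_add _ _).trans (max_le ?_ ?_)) ?_)
    · refine (totalDegree_mul _ _).trans ?_
      simpa using hpow d
    · refine totalDegree_finsetSum_le fun j hj => ?_
      have hj' := Finset.mem_Icc.1 hj
      refine (totalDegree_mul _ _).trans ((add_le_add ((totalDegree_mul _ _).trans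
        (add_le_add (totalDegree_C _).le ((totalDegree_rename_le _ _).trans
          (totalDegree_esymm_le _)))) (hpow j)).trans ?_)
      -- The coefficient has degree at most e = d - j, and e ≤ e * D because D ≥ 1.
      obtain ⟨e, rfl⟩ : ∃ e, d = j + e := ⟨d - j, by omega⟩
      rw [Nat.add_sub_cancel_left, zero_add, add_mul, add_comm]
      exact Nat.add_le_add_left (Nat.le_mul_of_pos_right e hD) _
    · rw [totalDegree_X_pow]
      exact Nat.le_mul_of_pos_right d hD
  · simp only [critPoly, map_add, map_mul, map_sum, map_pow, eval_C, eval_X, eval_rename,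
      Polynomial.eval_add, Polynomial.eval_mul, Polynomial.eval_C, Polynomial.eval_pow,
      Polynomial.eval_X, Polynomial.eval_finsetSum, paramA]
    congr 2
    refine Finset.sum_congr rfl fun j _ => ?_
    rw [show x ∘ Sum.inl = paramC x from rfl]
    ring

theorem exists_critOrbit_polynomial {d : ℕ} (hd : 1 ≤ d) (i : Fin (d - 1)) (k : ℕ) :
    ∃ q : MvPolynomial (ParamIndex d) ℂ, q.totalDegree ≤ d ^ k ∧
      ∀ x : ParamSpace d, eval x q = critOrbit x i k := by
  induction k with
  | zero => simpa [critOrbit] using exists_critPoint_polynomial i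
  | succ k ih =>
    obtain ⟨q, hq, hqx⟩ := ih
    obtain ⟨r, hr, hrx⟩ := exists_critPoly_comp_polynomial (Nat.one_le_pow k d hd) q hq
    refine ⟨r, by rwa [pow_succ'], fun x => ?_⟩
    rw [hrx, hqx, critOrbit, critOrbit, Function.iterate_succ_apply']

theorem exists_vanishingIdeal_perLocus {d : ℕ} (hd : 1 ≤ d) (i : Fin (d - 1)) {m n : ℕ}
    (hnm : n ≤ m) :
    ∃ g : MvPolynomial (ParamIndex d) ℂ, g.totalDegree ≤ d ^ m ∧
      vanishingIdeal ℂ (PerLocus (d := d) i m n) = Ideal.span {g} := by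
  obtain ⟨q, hq, hqx⟩ := exists_critOrbit_polynomial hd i m
  obtain ⟨r, hr, hrx⟩ := exists_critOrbit_polynomial hd i n
  obtain ⟨g, hg, hgI⟩ := exists_vanishingIdeal_eq_span (q - r)
  refine ⟨g, hg.trans ((totalDegree_sub _ _).trans
    (max_le hq (hr.trans (Nat.pow_le_pow_right hd hnm)))), ?_⟩
  rw [← hgI]
  congr 1
  ext x
  simp [PerLocus, hqx, hrx, sub_eq_zero]

end CriticalOrbits
-- Weak Bézout bound and exchange of equations
section Counting

variable {σ ι : Type*} [Fintype σ] [Fintype ι]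

/-- The coefficients of a polynomial at the monomials of degree at most `T` in each variable. -/
noncomputable def truncatedCoeffs (σ : Type*) [Fintype σ] (T : ℕ) :
    MvPolynomial σ ℂ →ₗ[ℂ] ((σ → Fin (T + 1)) → ℂ) :=
  LinearMap.pi fun e => lcoeff ℂ (Finsupp.equivFunOnFinite.symm fun s => (e s : ℕ))

theorem eq_zero_of_truncatedCoeffs_eq_zero {T : ℕ} {g : MvPolynomial σ ℂ}
    (hT : g.totalDegree ≤ T) (hg : truncatedCoeffs σ T g = 0) : g = 0 := by
  ext m
  by_contra hm
  have hle : ∀ s, m s < T + 1 := fun s => Nat.lt_succ_of_le <|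
    ((Finsupp.le_degree s m).trans (le_totalDegree (mem_support_iff.2 hm))).trans hT
  have := congrFun hg fun s => ⟨m s, hle s⟩
  refine hm ?_
  have hm' : (Finsupp.equivFunOnFinite.symm fun s => m s) = m := by ext; rfl
  simpa [truncatedCoeffs, lcoeff_apply, hm'] using this

/-- Counting of linearly independent products `f ^ β * u ^ k` in bounded degree. -/
theorem card_mul_prod_le (hcard : Fintype.card σ = Fintype.card ι)
    {f : ι → MvPolynomial σ ℂ} {D : ι → ℕ} (hD : ∀ i, (f i).totalDegree ≤ D i)
    {S : Finset (σ → ℂ)} (hS : ∀ p ∈ S, IsNondegenerateZero f p) (B : ι → ℕ) {T : ℕ}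
    (hT : ∑ i, B i * D i + S.card ≤ T) :
    S.card * ∏ i, B i ≤ (T + 1) ^ Fintype.card σ := by
  classical
  obtain ⟨c, hc⟩ := exists_linear_separating S
  let u : MvPolynomial σ ℂ := ∑ s, C (c s) * X s
  have hu : Set.InjOn (fun p => eval p u) S := by
    simpa [u] using hc
  have hudeg : u.totalDegree ≤ 1 := totalDegree_finsetSum_le fun s _ =>
    (totalDegree_mul _ _).trans (by simp)
  let a : ((Fin S.card × ∀ i, Fin (B i)) → ℂ) → Fin S.card → MvPolynomial ι ℂ := fun w k =>
    ∑ β : ∀ i, Fin (B i), monomial (Finsupp.equivFunOnFinite.symm fun i => (β i : ℕ)) (w (k, β))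
  let Φ : ((Fin S.card × ∀ i, Fin (B i)) → ℂ) →ₗ[ℂ] MvPolynomial σ ℂ :=
    Fintype.linearCombination ℂ fun q : Fin S.card × ∀ i, Fin (B i) =>
      (∏ i, f i ^ (q.2 i : ℕ)) * u ^ (q.1 : ℕ)
  have hΦ : ∀ w, Φ w = ∑ k, aeval f (a w k) * u ^ (k : ℕ) := by
    intro w
    simp only [Φ, a, Fintype.linearCombination_apply, Fintype.sum_prod_type, map_sum,
      Finset.sum_mul, aeval_monomial]
    refine Finset.sum_congr rfl fun k _ => Finset.sum_congr rfl fun β _ => ?_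
    rw [Finsupp.prod_fintype _ _ (fun _ => pow_zero _), Algebra.smul_def, mul_assoc]
    rfl
  have hdeg : ∀ w, (Φ w).totalDegree ≤ T := by
    intro w
    simp only [Φ, Fintype.linearCombination_apply]
    refine totalDegree_finsetSum_le fun q _ => (totalDegree_smul_le _ _).trans <|
      (totalDegree_mul _ _).trans <| le_trans (add_le_add ?_ ?_) hT
    · refine (totalDegree_finsetProd _ _).trans (Finset.sum_le_sum fun i _ => ?_)
      exact (totalDegree_pow _ _).trans (Nat.mul_le_mul (q.2 i).2.le (hD i))
    · refine (totalDegree_pow _ _).trans ((Nat.mul_le_mul q.1.2.le hudeg).trans (mul_one _).le)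
  -- The products f^β u^k are independent, and their combinations have degree at most T, hence are
  -- determined by `(T + 1) ^ card σ` coefficients.
  have hinj : Function.Injective (truncatedCoeffs σ T ∘ₗ Φ) := by
    rw [← LinearMap.ker_eq_bot, LinearMap.ker_eq_bot']
    intro w hw
    have h0 := eq_zero_of_truncatedCoeffs_eq_zero (hdeg w) hw
    rw [hΦ] at h0
    have h1 := eq_zero_of_sum_aeval_mul_pow_eq_zero hcard hS hu h0
    ext ⟨k, β⟩
    have := congrArg (coeff (Finsupp.equivFunOnFinite.symm fun i => (β i : ℕ))) (h1 k)
    rw [coeff_zero] at this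
    rw [Pi.zero_apply, ← this]
    simp only [a, coeff_sum, coeff_monomial]
    rw [Finset.sum_eq_single β]
    · simp
    · intro γ _ hγ
      refine if_neg fun h => hγ ?_
      ext i
      exact congrFun (Finsupp.equivFunOnFinite.symm.injective h) i
    · simp
  simpa using LinearMap.finrank_le_finrank_of_injective hinj

/-- A weak form of Bézout's inequality. -/
theorem card_nondegenerateZeros_le (hcard : Fintype.card σ = Fintype.card ι)
    {f : ι → MvPolynomial σ ℂ} {D : ι → ℕ} (hD : ∀ i, (f i).totalDegree ≤ D i)
    (hD1 : ∀ i, 1 ≤ D i) {S : Finset (σ → ℂ)} (hS : ∀ p ∈ S, IsNondegenerateZero f p) :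
    S.card ≤ (Fintype.card ι + 1) ^ Fintype.card ι * ∏ i, D i := by
  classical
  set N := Fintype.card ι
  set Q := ∏ i, D i
  have hQ : 1 ≤ Q := Nat.succ_le_of_lt (Finset.prod_pos fun i _ => hD1 i)
  let L := S.card + 1
  -- This choice makes every `B i * D i` equal to `L * Q`; taking L > #S lets the u-powers be
  -- absorbed in one more `L * Q`.
  let B : ι → ℕ := fun i => L * ∏ j ∈ Finset.univ.erase i, D j
  have hB : ∀ i, B i * D i = L * Q := fun i => by
    simp only [B, Q]
    rw [mul_assoc, Finset.prod_erase_mul _ _ (Finset.mem_univ i)]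
  have hsum : ∑ i, B i * D i = N * (L * Q) := by simp [hB, N]
  have h1 := card_mul_prod_le hcard hD hS B (T := N * (L * Q) + S.card) (by rw [hsum])
  have h2 : N * (L * Q) + S.card + 1 ≤ (N + 1) * (L * Q) := by
    have : L ≤ L * Q := Nat.le_mul_of_pos_right L hQ
    simp only [L] at this ⊢
    linarith
  have hLQ : 0 < (L * Q) ^ N := by positivity
  refine Nat.le_of_mul_le_mul_right ?_ hLQ
  calc S.card * (L * Q) ^ N = (S.card * ∏ i, B i) * Q := by
        rw [mul_assoc, ← Finset.prod_mul_distrib]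
        simp [hB, N]
    _ ≤ (N * (L * Q) + S.card + 1) ^ N * Q := by
        rw [hcard] at h1
        exact Nat.mul_le_mul_right _ h1
    _ ≤ ((N + 1) * (L * Q)) ^ N * Q := Nat.mul_le_mul_right _ (Nat.pow_le_pow_left h2 _)
    _ = (N + 1) ^ N * Q * (L * Q) ^ N := by rw [mul_pow]; ring

theorem nondegenerateZeros_finite_and_ncard_le (hcard : Fintype.card σ = Fintype.card ι)
    {f : ι → MvPolynomial σ ℂ} {D : ι → ℕ} (hD : ∀ i, (f i).totalDegree ≤ D i)
    (hD1 : ∀ i, 1 ≤ D i) :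
    {p | IsNondegenerateZero f p}.Finite ∧ {p | IsNondegenerateZero f p}.ncard ≤
      (Fintype.card ι + 1) ^ Fintype.card ι * ∏ i, D i := by
  have hfin : {p | IsNondegenerateZero f p}.Finite := by
    by_contra hinf
    obtain ⟨S, hS, hcS⟩ := Set.Infinite.exists_subset_card_eq hinf
      ((Fintype.card ι + 1) ^ Fintype.card ι * ∏ i, D i + 1)
    have := card_nondegenerateZeros_le hcard hD hD1 (S := S) fun p hp => hS hp
    omega
  refine ⟨hfin, ?_⟩
  rw [Set.ncard_eq_toFinset_card _ hfin]
  exact card_nondegenerateZeros_le hcard hD hD1 fun p hp => by simpa using hp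

/-- If one adds to a nondegenerate system an equation with nonzero differential, it can replace one
of the equations. -/
theorem IsNondegenerateZero.exists_update [DecidableEq ι]
    (hcard : Fintype.card σ = Fintype.card ι)
    {g : ι → MvPolynomial σ ℂ} {p : σ → ℂ} (hg : IsNondegenerateZero g p)
    {h : MvPolynomial σ ℂ} (hp : eval p h = 0) {s : σ} (hs : eval p (pderiv s h) ≠ 0) :
    ∃ j, IsNondegenerateZero (Function.update g j h) p := by
  classical
  let ℓ : (σ → ℂ) →ₗ[ℂ] (ι → ℂ) := LinearMap.pi fun i => (differentialAt (g i) p).toLinearMap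
  have hinj : Function.Injective ℓ := by
    rw [← LinearMap.ker_eq_bot, LinearMap.ker_eq_bot']
    exact fun v hv => hg.2 v fun i => congrFun hv i
  let E := LinearEquiv.ofInjectiveOfFinrankEq ℓ hinj (by simp [hcard])
  have hE : ∀ v i, E v i = differentialAt (g i) p v := fun v i => rfl
  -- The differential of h is nonzero, hence nonzero on some vector of the basis dual to the
  -- differentials of g; its index is the equation to drop.
  obtain ⟨j, hj⟩ : ∃ j, differentialAt h p (E.symm (Pi.single j 1)) ≠ 0 := by
    by_contra! H
    have h0 : (differentialAt h p).toLinearMap ∘ₗ E.symm.toLinearMap = 0 :=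
      LinearMap.pi_ext' fun j => LinearMap.ext_ring (by simpa using H j)
    refine hs ?_
    have := LinearMap.congr_fun h0 (E (Pi.single s 1))
    simpa [differentialAt_apply, Pi.single_apply] using this
  refine ⟨j, fun i => ?_, fun v hv => ?_⟩
  · by_cases hij : i = j
    · subst hij; simpa using hp
    · simpa [hij] using hg.1 i
  · have hEv : E v = E v j • Pi.single j 1 := by
      ext i
      by_cases hij : i = j
      · subst hij; simp
      · have := hv i
        rw [Function.update_of_ne hij] at this
        simp [hE, this, hij]
    have hv' : v = E v j • E.symm (Pi.single j 1) := by
      rw [← map_smul, ← hEv, E.symm_apply_apply]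
    have h0 := hv j
    rw [Function.update_self, hv', map_smul, smul_eq_mul] at h0
    have h1 := (mul_eq_zero.1 h0).resolve_right hj
    rw [hv', h1, zero_smul]

/-- The nondegenerate zeros of `g` on a fixed hypersurface `{f = 0}`. -/
theorem exists_ncard_inter_zeros_le [DecidableEq ι] (hcard : Fintype.card σ = Fintype.card ι)
    {f : MvPolynomial σ ℂ} (hf : f ≠ 0) :
    ∃ K : ℕ, ∀ (g : ι → MvPolynomial σ ℂ) (D : ι → ℕ), (∀ i, (g i).totalDegree ≤ D i) →
      (∀ i, 1 ≤ D i) → {p | eval p f = 0 ∧ IsNondegenerateZero g p}.Finite ∧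
      {p | eval p f = 0 ∧ IsNondegenerateZero g p}.ncard ≤
        ∑ j, K * ∏ i ∈ Finset.univ.erase j, D i := by
  obtain ⟨S, hS⟩ := exists_finset_simple_zero f hf
  set c := (Fintype.card ι + 1) ^ Fintype.card ι
  -- The `+ 1` keeps the degree bound of the new equation at least 1.
  refine ⟨∑ h ∈ S, c * (h.totalDegree + 1), fun g D hD hD1 => ?_⟩
  have hsub : {p | eval p f = 0 ∧ IsNondegenerateZero g p} ⊆
      ⋃ q ∈ Finset.univ ×ˢ S, {p | IsNondegenerateZero (Function.update g q.1 q.2) p} := by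
    rintro p ⟨hp, hgp⟩
    obtain ⟨h, hh, hp0, s, hs⟩ := hS p hp
    obtain ⟨j, hj⟩ := hgp.exists_update hcard hp0 hs
    simp only [Set.mem_iUnion]
    exact ⟨(j, h), by simpa using hh, hj⟩
  have hq : ∀ j (h : MvPolynomial σ ℂ),
      {p | IsNondegenerateZero (Function.update g j h) p}.Finite ∧
      {p | IsNondegenerateZero (Function.update g j h) p}.ncard ≤
        c * (h.totalDegree + 1) * ∏ i ∈ Finset.univ.erase j, D i := by
    intro j h
    have := nondegenerateZeros_finite_and_ncard_le hcard (f := Function.update g j h)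
      (D := Function.update D j (h.totalDegree + 1)) (fun i => ?_) (fun i => ?_)
    · rwa [← Finset.mul_prod_erase _ _ (Finset.mem_univ j), Function.update_self, ← mul_assoc,
        Finset.prod_congr rfl fun i hi => Function.update_of_ne (Finset.ne_of_mem_erase hi) _ _]
        at this
    · by_cases hij : i = j
      · subst hij; simp
      · simpa [hij] using hD i
    · by_cases hij : i = j
      · subst hij; simp
      · simpa [hij] using hD1 i
  have hfin : (⋃ q ∈ Finset.univ ×ˢ S,
      {p | IsNondegenerateZero (Function.update g q.1 q.2) p}).Finite :=
    (Finset.finite_toSet _).biUnion fun q _ => (hq q.1 q.2).1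
  refine ⟨hfin.subset hsub, (Set.ncard_le_ncard hsub hfin).trans ?_⟩
  refine (Finset.set_ncard_biUnion_le _ _).trans
    ((Finset.sum_le_sum fun q _ => (hq q.1 q.2).2).trans ?_)
  rw [Finset.sum_product]
  simp [Finset.sum_mul]

end Counting

/-! ### From transversality to nondegenerate zeros, and the asymptotics -/

theorem tangentSpaceAt_eq_ker {σ : Type*} [Fintype σ] {Z : Set (σ → ℂ)} {g : MvPolynomial σ ℂ}
    (hg : vanishingIdeal ℂ Z = Ideal.span {g}) {p : σ → ℂ} (hp : p ∈ Z) :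
    eval p g = 0 ∧ ∀ v, differentialAt g p v = 0 → v ∈ tangentSpaceAt Z p := by
  have hgp : eval p g = 0 := by
    have : g ∈ vanishingIdeal ℂ Z := hg ▸ Ideal.mem_span_singleton_self g
    simpa [aeval_eq_eval] using this p hp
  refine ⟨hgp, fun v hv f hf => ?_⟩
  rw [hg, Ideal.mem_span_singleton] at hf
  obtain ⟨h, rfl⟩ := hf
  rw [← differentialAt_apply, differentialAt_mul]
  simp [hgp, hv]

theorem mainTheorem8 (d : ℕ) (hd : 2 ≤ d)
    (m n : ℕ → Fin (d - 1) → ℕ)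
    (hmn : ∀ k i, n k i < m k i)
    (hm : ∀ i, Filter.Tendsto (fun k => m k i) Filter.atTop Filter.atTop)
    (V : Set (ParamSpace d)) (hV : IsAlgebraicSubset V) (hV' : V ≠ Set.univ) :
    (∀ k, (V ∩ TPCF (m k) (n k)).Finite) ∧
    Asymptotics.IsLittleO Filter.atTop
      (fun k => ((V ∩ TPCF (m k) (n k)).ncard : ℝ))
      (fun k => (d : ℝ) ^ (∑ i, m k i)) := by
  have hcard : Fintype.card (ParamIndex d) = Fintype.card (Fin (d - 1)) := by
    simp only [Fintype.card_sum, Fintype.card_fin, Fintype.card_unit]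
    omega
  obtain ⟨f, hf, hfV⟩ : ∃ f : MvPolynomial (ParamIndex d) ℂ, f ≠ 0 ∧ ∀ x ∈ V, eval x f = 0 := by
    obtain ⟨I, rfl⟩ := hV
    by_contra! H
    refine hV' (Set.eq_univ_of_forall fun x f hf => ?_)
    by_cases h0 : f = 0
    · simp [h0]
    · obtain ⟨y, hy, hy'⟩ := H f h0
      exact (hy' (by simpa [aeval_eq_eval] using hy f hf)).elim
  obtain ⟨K, hK⟩ := exists_ncard_inter_zeros_le (ι := Fin (d - 1)) hcard hf
  have hbound : ∀ k, (V ∩ TPCF (m k) (n k)).Finite ∧ (V ∩ TPCF (m k) (n k)).ncard ≤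
      ∑ j, K * ∏ i ∈ Finset.univ.erase j, d ^ m k i := by
    intro k
    choose g hgD hgI using fun i =>
      exists_vanishingIdeal_perLocus (d := d) (by omega) i (hmn k i).le
    have hsub : V ∩ TPCF (m k) (n k) ⊆ {p | eval p f = 0 ∧ IsNondegenerateZero g p} := by
      rintro p ⟨hpV, hpcf, -, htr⟩
      have hker := fun i => tangentSpaceAt_eq_ker (hgI i) (Set.mem_iInter.1 hpcf i)
      refine ⟨hfV p hpV, fun i => (hker i).1, fun v hv => ?_⟩
      -- There are as many hypersurfaces as coordinates, so transversality leaves no common tangent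
      -- vector.
      have h0 : (⨅ i, tangentSpaceAt (PerLocus i (m k i) (n k i)) p) = ⊥ := by
        rw [HypersurfacesTransverseAt, hcard] at htr
        exact Submodule.finrank_eq_zero.1 (by omega)
      rw [← Submodule.mem_bot ℂ, ← h0, Submodule.mem_iInf]
      exact fun i => (hker i).2 v (hv i)
    obtain ⟨h1, h2⟩ := hK g _ hgD fun i => Nat.one_le_pow _ _ (by omega)
    exact ⟨h1.subset hsub, (Set.ncard_le_ncard hsub h1).trans h2⟩
  refine ⟨fun k => (hbound k).1, ?_⟩
  have hd0 : (d : ℝ) ≠ 0 := by positivity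
  have hlim : Tendsto (fun k => ∑ j, (K : ℝ) * ((d : ℝ)⁻¹) ^ m k j) atTop (𝓝 0) := by
    have hpow : Tendsto (fun e : ℕ => ((d : ℝ)⁻¹) ^ e) atTop (𝓝 0) :=
      tendsto_pow_atTop_nhds_zero_of_lt_one (by positivity)
        (inv_lt_one_of_one_lt₀ (by exact_mod_cast hd))
    simpa using tendsto_finsetSum Finset.univ fun j _ =>
      (hpow.comp (hm j)).const_mul (K : ℝ)
  -- The j-th term of the bound lacks the factor `d ^ m k j`, so relative to `d ^ ∑ i, m k i` it is
  -- `K * d⁻¹ ^ m k j`.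
  have hO : (fun k => ((V ∩ TPCF (m k) (n k)).ncard : ℝ)) =O[atTop]
      fun k => (∑ j, (K : ℝ) * ((d : ℝ)⁻¹) ^ m k j) * (d : ℝ) ^ (∑ i, m k i) := by
    refine Asymptotics.IsBigO.of_bound 1 (Eventually.of_forall fun k => ?_)
    rw [one_mul, Real.norm_of_nonneg (by positivity), Real.norm_of_nonneg (by positivity)]
    have h : ((V ∩ TPCF (m k) (n k)).ncard : ℝ) ≤
        ((∑ j, K * ∏ i ∈ Finset.univ.erase j, d ^ m k i : ℕ) : ℝ) := by exact_mod_cast (hbound k).2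
    refine h.trans_eq ?_
    push_cast
    rw [Finset.sum_mul]
    refine Finset.sum_congr rfl fun j _ => ?_
    rw [← Finset.prod_pow_eq_pow_sum, ← Finset.mul_prod_erase _ _ (Finset.mem_univ j), inv_pow]
    field_simp
  refine hO.trans_isLittleO ?_
  simpa using ((Asymptotics.isLittleO_one_iff ℝ).2 hlim).mul_isBigO
    (Asymptotics.isBigO_refl (fun k => (d : ℝ) ^ (∑ i, m k i)) atTop)
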